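/- **Setting.** For $A\in\mathbb R^{m\times n}$ with singular value decomposition $A=U\Sigma V^T=\sum_i\sigma_iu_iv_i^T$ ($\sigma_1\ge\sigma_2\ge\dots\ge0$), let $\ell(\lambda)=\max\{i:\sigma_i\ge\lambda\}$ (and $0$ if there is no such $i$), and let $A_k=A\Pi_k$ with $\Pi_k$ the orthogonal projector onto $\operatorname{span}\{v_1,\dots,v_k\}$. For a nonzero vector $x$ let $\mathcal D_x(i)=x_i^2/\|x\|^2$. Write $A_i$ for the $i$-th row of $A$ and $\tilde A$ for the vector with entries $\|A_i\|$. **Algorithm ModFKV.** Given $\sigma\in(0,\|A\|_F]$, $\varepsilon\in\big(0,\tfrac14\sqrt{\sigma/\|A\|_F}\,\big]$, $\eta\in[\varepsilon^2,1]$ and a sample size $q$, put $K=\|A\|_F^2/\sigma^2$ and $\bar\varepsilon=\eta\varepsilon^2$. Draw rows $i_1,\dots,i_q$ independently from $\mathcal D_{\tilde A}$; then draw columns $j_1,\dots,j_q$ independently from $\mathcal F=\frac1q\sum_{s=1}^q\mathcal D_{A_{i_s}}$. Let $W\in\mathbb R^{q\times q}$ have entries $$W_{rc}=\frac{A_{i_rj_c}}{q\sqrt{\mathcal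 D_{\tilde A}(i_r)\,\mathcal F(j_c)}},$$ and let $S\in\mathbb R^{q\times n}$ have rows $A_{i_r}/\sqrt{q\,\mathcal D_{\tilde A}(i_r)}$. From a singular value decomposition of $W$, take the left singular vectors $u^{(1)},\dots,u^{(k)}$ belonging to the singular values $\sigma^{(1)},\dots,\sigma^{(k)}$ of $W$ that are larger than $\sigma$. Let $\hat U=(u^{(1)}\,\cdots\,u^{(k)})$, $\hat\Sigma=\operatorname{diag}(\sigma^{(1)},\dots,\sigma^{(k)})$, $\hat V=S^T\hat U\hat\Sigma^{-1}\in\mathbb R^{n\times k}$ and $D=A\hat V\hat V^T$. **Lemma.** For every constant failure probability $\delta\in(0,1)$ there is a constant $C>0$, depending only on $\delta$, such that for all $m,n,A,\sigma,\varepsilon,\eta$ as above and every sample size $q\ge C\,K^4/\bar\varepsilon^2$ (so that $q=\Theta(K^4/\bar\varepsilon^2)$ samples are enough), the following hold simultaneously with probability at least $1-\delta$, whichever singular value decomposition of $W$ is used: $$\|A-D\|_F^2\le\|A-A_k\|_F^2+\bar\varepsilon\|A\|_F^2,\qquad \operatorname{rank}D\le k,$$ $$\ell\big((1+\bar\varepsilon\sqrt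 K)\sigma\big)\le k\le\ell\big((1-\bar\varepsilon\sqrt K)\sigma\big).$$ -/

import Mathlib

attribute [local instance] Matrix.frobeniusNormedAddCommGroup

/-- The `m × n` rectangular diagonal matrix with diagonal `s`. -/
def rectDiag {m n : ℕ} (s : Fin (min m n) → ℝ) : Matrix (Fin m) (Fin n) ℝ :=
  Matrix.of fun i j =>
    if h : (i : ℕ) = (j : ℕ) then s ⟨i, lt_min i.isLt (h ▸ j.isLt)⟩ else 0

/-- `A = U Σ Vᵀ` is a (full) singular value decomposition of `A`, the diagonal `s` of `Σ` being
nonnegative and nonincreasing. The `i`-th columns of `U` and `V` are the left and right singular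
vectors belonging to `s i`. -/
structure IsSVD {m n : ℕ} (A : Matrix (Fin m) (Fin n) ℝ) (U : Matrix (Fin m) (Fin m) ℝ)
    (s : Fin (min m n) → ℝ) (V : Matrix (Fin n) (Fin n) ℝ) : Prop where
  left_orthogonal : U ∈ Matrix.orthogonalGroup (Fin m) ℝ
  right_orthogonal : V ∈ Matrix.orthogonalGroup (Fin n) ℝ
  nonneg : ∀ i, 0 ≤ s i
  antitone : Antitone s
  eq : A = U * rectDiag s * V.transpose

/-- `ℓ(lam) = max {i | σ_i ≥ lam}` for the singular values `σ_1 ≥ σ_2 ≥ …` listed by `s`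
(`σ_i = s (i - 1)`); it is `0` if there is no such `i`. -/
noncomputable def ell {N : ℕ} (s : Fin N → ℝ) (lam : ℝ) : ℕ :=
  (Finset.univ.filter fun i : Fin N => lam ≤ s i).sup fun i => (i : ℕ) + 1

/-- `A_k = A Π_k`, where `Π_k` is the orthogonal projector onto the span of the first `k` right
singular vectors (columns of `V`). -/
noncomputable def truncation {m n : ℕ} (A : Matrix (Fin m) (Fin n) ℝ)
    (V : Matrix (Fin n) (Fin n) ℝ) (k : ℕ) : Matrix (Fin m) (Fin n) ℝ :=
  A * ∑ i ∈ Finset.univ.filter (fun i : Fin n => (i : ℕ) < k),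
    Matrix.vecMulVec (V.col i) (V.col i)

/-- The density `𝓓_x(i) = x_i² / ‖x‖²`. -/
noncomputable def lengthSqDist {n : ℕ} (x : EuclideanSpace ℝ (Fin n)) (i : Fin n) : ℝ :=
  x i ^ 2 / ‖x‖ ^ 2

/-- The `i`-th row of `A`. -/
noncomputable def rowVec {m n : ℕ} (A : Matrix (Fin m) (Fin n) ℝ) (i : Fin m) :
    EuclideanSpace ℝ (Fin n) :=
  WithLp.toLp 2 (A i)

/-- The vector `Ã` of row norms of `A`. -/
noncomputable def rowNorms {m n : ℕ} (A : Matrix (Fin m) (Fin n) ℝ) :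
    EuclideanSpace ℝ (Fin m) :=
  WithLp.toLp 2 fun i => ‖rowVec A i‖

/-- The density of the column distribution `𝓕` for the sampled rows `I 0, …, I (q-1)`: choose
`r` uniformly, then a column from `𝓓_{A_{I r}}`. -/
noncomputable def colDist {m n q : ℕ} (A : Matrix (Fin m) (Fin n) ℝ) (I : Fin q → Fin m)
    (j : Fin n) : ℝ :=
  ∑ r, (1 / (q : ℝ)) * lengthSqDist (rowVec A (I r)) j

/-- The probability that the sampling phase draws the rows `ω.1` (independently from `𝓓_Ã`) and
then the columns `ω.2` (independently from `𝓕`, given the rows). -/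
noncomputable def sampleWeight {m n q : ℕ} (A : Matrix (Fin m) (Fin n) ℝ)
    (ω : (Fin q → Fin m) × (Fin q → Fin n)) : ℝ :=
  (∏ r, lengthSqDist (rowNorms A) (ω.1 r)) * ∏ c, colDist A ω.1 (ω.2 c)

/-- The probability of the event `E` under the sampling phase with `q` rows and `q` columns. -/
noncomputable def sampleProb {m n q : ℕ} (A : Matrix (Fin m) (Fin n) ℝ)
    (E : Set ((Fin q → Fin m) × (Fin q → Fin n))) : ℝ :=
  ∑ ω, E.indicator (sampleWeight A) ω

/-- The renormalized row sample `S`. -/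
noncomputable def rowSample {m n q : ℕ} (A : Matrix (Fin m) (Fin n) ℝ) (I : Fin q → Fin m) :
    Matrix (Fin q) (Fin n) ℝ :=
  Matrix.of fun r j => A (I r) j / √((q : ℝ) * lengthSqDist (rowNorms A) (I r))

/-- The row-and-column-normalized submatrix `W`. -/
noncomputable def subsample {m n q : ℕ} (A : Matrix (Fin m) (Fin n) ℝ) (I : Fin q → Fin m)
    (J : Fin q → Fin n) : Matrix (Fin q) (Fin q) ℝ :=
  Matrix.of fun r c =>
    A (I r) (J c) / ((q : ℝ) * √(lengthSqDist (rowNorms A) (I r) * colDist A I (J c)))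

/-- The number `k` of singular values in the list `t` that are larger than the threshold. -/
noncomputable def numAbove {N : ℕ} (t : Fin N → ℝ) (σ : ℝ) : ℕ :=
  (Finset.univ.filter fun a => σ < t a).card

theorem numAbove_le {N : ℕ} (t : Fin N → ℝ) (σ : ℝ) : numAbove t σ ≤ N :=
  (Finset.card_filter_le _ _).trans (by simp)

/-- `Û`: the left singular vectors of `W` (the columns of `P`) whose singular values are larger
than `σ`. As the singular values `t` are nonincreasing, these are the first `k` columns. -/
noncomputable def leftVecs {q : ℕ} (P : Matrix (Fin q) (Fin q) ℝ) (t : Fin (min q q) → ℝ)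
    (σ : ℝ) : Matrix (Fin q) (Fin (numAbove t σ)) ℝ :=
  Matrix.of fun r a => P r (Fin.castLE ((numAbove_le t σ).trans (min_le_left q q)) a)

/-- `Σ̂`: the diagonal matrix of the singular values of `W` that are larger than `σ`. -/
noncomputable def topVals {N : ℕ} (t : Fin N → ℝ) (σ : ℝ) :
    Matrix (Fin (numAbove t σ)) (Fin (numAbove t σ)) ℝ :=
  Matrix.diagonal fun a => t (Fin.castLE (numAbove_le t σ) a)

/-- `V̂ = Sᵀ Û Σ̂⁻¹`. -/
noncomputable def approxRight {m n q : ℕ} (A : Matrix (Fin m) (Fin n) ℝ) (I : Fin q → Fin m)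
    (P : Matrix (Fin q) (Fin q) ℝ) (t : Fin (min q q) → ℝ) (σ : ℝ) :
    Matrix (Fin n) (Fin (numAbove t σ)) ℝ :=
  (rowSample A I).transpose * leftVecs P t σ * (topVals t σ)⁻¹

/-- The output matrix `D = A V̂ V̂ᵀ`, when the rows `I` have been sampled and the singular value
decomposition of `W` that is computed has left singular vectors `P` and singular values `t`. -/
noncomputable def outputMatrix {m n q : ℕ} (A : Matrix (Fin m) (Fin n) ℝ) (I : Fin q → Fin m)
    (P : Matrix (Fin q) (Fin q) ℝ) (t : Fin (min q q) → ℝ) (σ : ℝ) :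
    Matrix (Fin m) (Fin n) ℝ :=
  A * approxRight A I P t σ * (approxRight A I P t σ).transpose

theorem lengthSqDist_sum {n : ℕ} (x : EuclideanSpace ℝ (Fin n)) (hx : x ≠ 0) :
    ∑ i, lengthSqDist x i = 1 := by
  have h : ‖x‖ ^ 2 ≠ 0 := pow_ne_zero _ (norm_ne_zero_iff.2 hx)
  simp only [lengthSqDist, ← Finset.sum_div]
  rw [div_eq_one_iff_eq h, EuclideanSpace.real_norm_sq_eq]

theorem lengthSqDist_nonneg {n : ℕ} (x : EuclideanSpace ℝ (Fin n)) (i : Fin n) :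
    0 ≤ lengthSqDist x i := by unfold lengthSqDist; positivity

theorem sampleWeight_nonneg {m n q : ℕ} (A : Matrix (Fin m) (Fin n) ℝ)
    (ω : (Fin q → Fin m) × (Fin q → Fin n)) : 0 ≤ sampleWeight A ω :=
  mul_nonneg (Finset.prod_nonneg fun _ _ => lengthSqDist_nonneg _ _)
    (Finset.prod_nonneg fun _ _ => Finset.sum_nonneg fun _ _ =>
      mul_nonneg (by positivity) (lengthSqDist_nonneg _ _))

/-- The sampling weights of a nonzero matrix form a probability distribution. -/
theorem sampleProb_univ {m n q : ℕ} (A : Matrix (Fin m) (Fin n) ℝ) (hA : A ≠ 0) (hq : 0 < q) :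
    sampleProb A (Set.univ : Set ((Fin q → Fin m) × (Fin q → Fin n))) = 1 := by
  have hrow : rowNorms A ≠ 0 := by
    intro h
    apply hA
    ext i j
    have h1 : ‖rowVec A i‖ = 0 := congrArg (fun x : EuclideanSpace ℝ (Fin m) => x i) h
    exact congrArg (fun x : EuclideanSpace ℝ (Fin n) => x j) (norm_eq_zero.1 h1)
  have hcol : ∀ I : Fin q → Fin m, (∏ r, lengthSqDist (rowNorms A) (I r)) *
      ∑ J : Fin q → Fin n, ∏ c, colDist A I (J c) = ∏ r, lengthSqDist (rowNorms A) (I r) := by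
    intro I
    by_cases h : ∃ r, rowVec A (I r) = 0
    · obtain ⟨r, hr⟩ := h
      have : ∏ r, lengthSqDist (rowNorms A) (I r) = 0 :=
        Finset.prod_eq_zero (Finset.mem_univ r) (by simp [lengthSqDist, rowNorms, hr])
      simp [this]
    · push Not at h
      have h1 : ∑ j, colDist A I j = 1 := by
        unfold colDist
        rw [Finset.sum_comm]
        simp only [← Finset.mul_sum]
        rw [Finset.sum_congr rfl fun r _ => lengthSqDist_sum _ (h r)]
        have : (q : ℝ) ≠ 0 := by positivity
        simp [this]
      have h2 := Finset.prod_univ_sum (fun _ : Fin q => Finset.univ) (fun _ j => colDist A I j)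
      simp only [h1, Finset.prod_const_one, Fintype.piFinset_univ] at h2
      rw [← h2, mul_one]
  simp only [sampleProb, Set.indicator_univ, Fintype.sum_prod_type, sampleWeight,
    ← Finset.mul_sum, hcol]
  have h2 := Finset.prod_univ_sum (fun _ : Fin q => Finset.univ)
    (fun _ i => lengthSqDist (rowNorms A) i)
  simp only [lengthSqDist_sum _ hrow, Finset.prod_const_one, Fintype.piFinset_univ] at h2
  exact h2.symm

/-! Write `F = ‖A‖` (Frobenius), `e` for the accuracy `η ε²`, and `θ = e σ⁴ / (8 F²)`. The argument
splits into a random part, which makes two Gram matrices close, and a deterministic part, which uses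
only that closeness.

Random part. Both draws are the same operation, norm-squared row sampling: applied to `A` it gives
`S`, applied to `Sᵀ` it gives `Wᵀ`. It estimates the Gram matrix without bias, and its mean square
Frobenius error is at most `F⁴ / q` (`sum_prod_mul_gram_error_le`). On the support of the sampling
`‖S‖ = ‖W‖ = F` exactly. Markov's inequality at level `θ²` gives `‖SᵀS - AᵀA‖ ≤ θ` and `‖SSᵀ - WWᵀ‖
≤ θ` outside probability `2F⁴ / (q θ²) = 128 K⁴ / (q e²)`.

Deterministic part (`outputMatrix_guarantee`). A min-max argument through `S` shows that the squared
singular values of `A` and `W` differ by at most `2θ` (`eigenvalue_le_add`), so thresholding `W` at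
`σ` is thresholding `A` within `e F` of `σ`. For the error, `R = V̂` is nearly orthonormal and `‖A
R‖²` is nearly the sum of the `k` retained squared singular values of `W`
(`norm_sub_mul_transpose_sq_le`). This sum differs little from the first `k` squared singular values
of `A`, by which `‖A - A_k‖²` falls short of `F²`. All losses together are at most `6/8` of `e F²`.
-/

open Matrix in
/-- The squared Frobenius norm is the sum of the squared entries. -/
theorem frobenius_sq {ι κ : Type*} [Fintype ι] [Fintype κ] (M : Matrix ι κ ℝ) :
    ‖M‖ ^ 2 = ∑ i, ∑ j, M i j ^ 2 := by
  have h : 0 ≤ ∑ i, ∑ j, M i j ^ 2 :=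
    Finset.sum_nonneg fun _ _ => Finset.sum_nonneg fun _ _ => sq_nonneg _
  rw [frobenius_norm_def, ← Real.sqrt_eq_rpow]
  simp only [Real.rpow_two, Real.norm_eq_abs, sq_abs]
  exact Real.sq_sqrt h

/-! ### Second moment of norm-squared row sampling -/

section Sampling

variable {ι : Type*} [Fintype ι]

theorem sum_pi_cons {q : ℕ} (F : (Fin (q + 1) → ι) → ℝ) :
    ∑ I, F I = ∑ i, ∑ J : Fin q → ι, F (Fin.cons i J) := by
  rw [← (Fin.consEquiv (fun _ => ι)).sum_comp, Fintype.sum_prod_type]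
  rfl

theorem sum_prod_eq_one {p : ι → ℝ} (hp : ∑ i, p i = 1) (q : ℕ) :
    ∑ I : Fin q → ι, ∏ r, p (I r) = 1 := by
  rw [← Fintype.sum_pow, hp, one_pow]

/-- A sum of independent centred variables is centred. -/
theorem sum_prod_mul_sum {p g : ι → ℝ} (hp : ∑ i, p i = 1) (hg : ∑ i, p i * g i = 0) (q : ℕ) :
    ∑ I : Fin q → ι, (∏ r, p (I r)) * ∑ r, g (I r) = 0 := by
  induction q with
  | zero => simp
  | succ q ih =>
    rw [sum_pi_cons]
    have h : ∀ (i : ι) (J : Fin q → ι),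
        (∏ r, p ((Fin.cons i J : Fin (q + 1) → ι) r)) *
          ∑ r, g ((Fin.cons i J : Fin (q + 1) → ι) r) =
        (p i * g i) * (∏ r, p (J r)) + p i * ((∏ r, p (J r)) * ∑ r, g (J r)) := by
      intro i J
      simp only [Fin.prod_univ_succ, Fin.sum_univ_succ, Fin.cons_zero, Fin.cons_succ]
      ring
    simp only [h, Finset.sum_add_distrib, ← Finset.mul_sum, ih, sum_prod_eq_one hp]
    simp [hg]

/-- The variance of a sum of independent centred variables is the sum of the variances. -/
theorem sum_prod_mul_sum_sq {p g : ι → ℝ} (hp : ∑ i, p i = 1) (hg : ∑ i, p i * g i = 0)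
    (q : ℕ) :
    ∑ I : Fin q → ι, (∏ r, p (I r)) * (∑ r, g (I r)) ^ 2 = q * ∑ i, p i * g i ^ 2 := by
  induction q with
  | zero => simp
  | succ q ih =>
    rw [sum_pi_cons]
    have h : ∀ (i : ι) (J : Fin q → ι),
        (∏ r, p ((Fin.cons i J : Fin (q + 1) → ι) r)) *
          (∑ r, g ((Fin.cons i J : Fin (q + 1) → ι) r)) ^ 2 =
        (p i * g i ^ 2) * (∏ r, p (J r)) + 2 * (p i * g i) * ((∏ r, p (J r)) * ∑ r, g (J r))
          + p i * ((∏ r, p (J r)) * (∑ r, g (J r)) ^ 2) := by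
      intro i J
      simp only [Fin.prod_univ_succ, Fin.sum_univ_succ, Fin.cons_zero, Fin.cons_succ]
      ring
    simp only [h, Finset.sum_add_distrib, ← Finset.mul_sum, ih, sum_prod_eq_one hp,
      sum_prod_mul_sum hp hg]
    simp only [mul_one, mul_zero, Finset.sum_const_zero, add_zero, ← Finset.sum_mul, hp]
    push_cast
    ring

/-- The rows of `B` with indices `I`, rescaled for sampling from `p`. -/
noncomputable def scaledRows {κ : Type*} {q : ℕ} (p : ι → ℝ) (B : Matrix ι κ ℝ)
    (I : Fin q → ι) : Matrix (Fin q) κ ℝ :=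
  Matrix.of fun r k => B (I r) k / √((q : ℝ) * p (I r))

/-- Norm-squared row sampling estimates the Gram matrix with small mean square error. -/
theorem sum_prod_mul_gram_error_le {κ : Type*} [Fintype κ] {p : ι → ℝ} {B : Matrix ι κ ℝ}
    (hp0 : ∀ i, 0 ≤ p i) (hp : ∑ i, p i = 1) (hB : ∀ i, p i * ‖B‖ ^ 2 = ∑ k, B i k ^ 2)
    {q : ℕ} (hq : 0 < q) :
    ∑ I : Fin q → ι, (∏ r, p (I r)) *
        ‖(scaledRows p B I).transpose * scaledRows p B I - B.transpose * B‖ ^ 2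
      ≤ ‖B‖ ^ 4 / q := by
  have hq' : (0 : ℝ) < q := by exact_mod_cast hq
  -- Rows of probability zero vanish, so the convention `x / 0 = 0` does not bias the estimator.
  have hzero : ∀ i, p i = 0 → ∀ k, B i k = 0 := by
    intro i hi k
    have h := hB i
    rw [hi, zero_mul] at h
    have := (Finset.sum_eq_zero_iff_of_nonneg (fun _ _ => sq_nonneg _)).1 h.symm k
      (Finset.mem_univ k)
    simpa using this
  -- `f a b` is the one-sample estimator of the entry `e a b` of `BᵀB`; the sampled Gram matrix is
  -- an average of `q` independent copies.
  let f : κ → κ → ι → ℝ := fun a b i => B i a * B i b / p i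
  let e : κ → κ → ℝ := fun a b => ∑ i, B i a * B i b
  have hpf : ∀ a b i, p i * f a b i = B i a * B i b := by
    intro a b i
    by_cases h : p i = 0
    · simp [h, hzero i h]
    · simp only [f]; field_simp
  have hmean : ∀ a b, ∑ i, p i * (f a b i - e a b) = 0 := by
    intro a b
    simp only [mul_sub, Finset.sum_sub_distrib, hpf, ← Finset.sum_mul, hp]
    simp [e]
  have hvar : ∀ a b, ∑ i, p i * (f a b i - e a b) ^ 2 ≤ ∑ i, p i * f a b i ^ 2 := by
    intro a b
    have h : ∀ i, p i * (f a b i - e a b) ^ 2 =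
        p i * f a b i ^ 2 - 2 * e a b * (p i * f a b i) + e a b ^ 2 * p i := fun i => by ring
    simp only [h, Finset.sum_add_distrib, Finset.sum_sub_distrib, ← Finset.mul_sum, hp, hpf]
    have : ∑ i, B i a * B i b = e a b := rfl
    rw [this]
    nlinarith [sq_nonneg (e a b)]
  have hentry : ∀ (I : Fin q → ι) (a b : κ),
      ((scaledRows p B I).transpose * scaledRows p B I - B.transpose * B) a b
        = (∑ r, (f a b (I r) - e a b)) / q := by
    intro I a b
    have h1 : ∀ r, B (I r) a / √((q : ℝ) * p (I r)) * (B (I r) b / √((q : ℝ) * p (I r)))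
        = f a b (I r) / q := by
      intro r
      rw [div_mul_div_comm, Real.mul_self_sqrt (mul_nonneg hq'.le (hp0 _)), mul_comm (q : ℝ),
        ← div_div]
    simp only [Matrix.sub_apply, Matrix.mul_apply, Matrix.transpose_apply, scaledRows,
      Matrix.of_apply, h1, Finset.sum_sub_distrib, ← Finset.sum_div]
    simp only [Finset.sum_const, Finset.card_univ, Fintype.card_fin, nsmul_eq_mul, e]
    field_simp
  have hab : ∀ a b, ∑ I : Fin q → ι, (∏ r, p (I r)) *
      ((∑ r, (f a b (I r) - e a b)) / q) ^ 2 ≤ (∑ i, p i * f a b i ^ 2) / q := by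
    intro a b
    simp only [div_pow, ← mul_div_assoc, ← Finset.sum_div]
    rw [sum_prod_mul_sum_sq hp (hmean a b), div_le_div_iff₀ (by positivity) hq']
    nlinarith [mul_le_mul_of_nonneg_left (hvar a b) (sq_nonneg (q : ℝ))]
  -- The choice of `p` enters here: the sum is the fourth power of the row norm over `p i`, and the
  -- squared row norm is `p i * ‖B‖ ^ 2`.
  have hsq : ∀ i, ∑ a, ∑ b, p i * f a b i ^ 2 = p i * ‖B‖ ^ 4 := by
    intro i
    by_cases h : p i = 0
    · simp [h]
    · have : ∀ a b, p i * f a b i ^ 2 = (p i)⁻¹ * (B i a ^ 2 * B i b ^ 2) := by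
        intro a b; simp only [f]; field_simp
      simp only [this, ← Finset.mul_sum, ← Finset.sum_mul, ← hB i]
      field_simp
  calc _ = ∑ a, ∑ b, ∑ I : Fin q → ι, (∏ r, p (I r)) *
      ((∑ r, (f a b (I r) - e a b)) / q) ^ 2 := by
        simp only [frobenius_sq, hentry, Finset.mul_sum]
        rw [Finset.sum_comm]
        exact Finset.sum_congr rfl fun a _ => Finset.sum_comm
    _ ≤ ∑ a, ∑ b, (∑ i, p i * f a b i ^ 2) / q :=
        Finset.sum_le_sum fun a _ => Finset.sum_le_sum fun b _ => hab a b
    _ = (∑ i, ∑ a, ∑ b, p i * f a b i ^ 2) / q := by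
        simp only [← Finset.sum_div]
        congr 1
        exact (Finset.sum_congr rfl fun a _ => Finset.sum_comm).trans Finset.sum_comm
    _ = ‖B‖ ^ 4 / q := by
        simp only [hsq, ← Finset.sum_mul, hp, one_mul]

end Sampling

/-! ### Perturbation bounds in the Frobenius norm -/

section Frobenius

open Matrix

variable {ι κ ρ α : Type*} [Fintype ι] [Fintype κ] [Fintype ρ] [Fintype α]

theorem frobenius_sq_eq_trace (M : Matrix ι κ ℝ) : ‖M‖ ^ 2 = (Mᵀ * M).trace := by
  rw [frobenius_sq, Finset.sum_comm]
  simp only [trace, diag, mul_apply, transpose_apply, sq]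

theorem abs_trace_transpose_mul_le (M N : Matrix ι κ ℝ) : |(Mᵀ * N).trace| ≤ ‖M‖ * ‖N‖ := by
  have h : (Mᵀ * N).trace = ∑ x : ι × κ, M x.1 x.2 * N x.1 x.2 := by
    rw [Fintype.sum_prod_type, Finset.sum_comm]
    simp only [trace, diag, mul_apply, transpose_apply]
  apply abs_le_of_sq_le_sq _ (by positivity)
  rw [h, mul_pow, frobenius_sq, frobenius_sq, ← Fintype.sum_prod_type', ← Fintype.sum_prod_type']
  exact Finset.sum_mul_sq_le_sq_mul_sq _ _ _

theorem abs_trace_conj_le (E : Matrix ι ι ℝ) (X : Matrix ι κ ℝ) :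
    |(Xᵀ * E * X).trace| ≤ ‖E‖ * ‖X‖ ^ 2 := by
  rw [Matrix.mul_assoc]
  refine (abs_trace_transpose_mul_le _ _).trans ?_
  nlinarith [mul_le_mul_of_nonneg_left (frobenius_norm_mul E X) (norm_nonneg X)]

theorem trace_conj_diagonal [DecidableEq ι] (g : ι → ℝ) (c : Matrix ι κ ℝ) :
    (cᵀ * diagonal g * c).trace = ∑ i, g i * ∑ k, c i k ^ 2 := by
  simp only [trace, diag, mul_apply (N := c), mul_diagonal, transpose_apply, Finset.mul_sum]
  rw [Finset.sum_comm]
  exact Finset.sum_congr rfl fun i _ => Finset.sum_congr rfl fun k _ => by ring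

theorem norm_isometry_mul [DecidableEq α] {X : Matrix ι α ℝ} (hX : Xᵀ * X = 1)
    (c : Matrix α κ ℝ) : ‖X * c‖ = ‖c‖ := by
  apply (sq_eq_sq₀ (norm_nonneg _) (norm_nonneg _)).1
  rw [frobenius_sq_eq_trace, frobenius_sq_eq_trace, transpose_mul, Matrix.mul_assoc,
    ← Matrix.mul_assoc Xᵀ, hX, Matrix.one_mul]

/-- Pythagoras: `X Xᵀ` is an orthogonal projector, so `‖M‖² = ‖M X‖² + ‖M - M X Xᵀ‖²`. -/
theorem norm_mul_isometry_le [DecidableEq α] {X : Matrix ι α ℝ} (hX : Xᵀ * X = 1)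
    (M : Matrix κ ι ℝ) : ‖M * X‖ ≤ ‖M‖ := by
  apply le_of_sq_le_sq _ (norm_nonneg _)
  have h : ‖M - M * X * Xᵀ‖ ^ 2 = ‖M‖ ^ 2 - ‖M * X‖ ^ 2 := by
    rw [← frobenius_norm_transpose (M - _), ← frobenius_norm_transpose M,
      ← frobenius_norm_transpose (M * X), frobenius_sq_eq_trace, frobenius_sq_eq_trace,
      frobenius_sq_eq_trace]
    have h1 : (M * X * Xᵀ) * (M * X * Xᵀ)ᵀ = M * X * (M * X)ᵀ := by
      rw [transpose_mul (M * X), transpose_transpose, Matrix.mul_assoc (M * X),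
        ← Matrix.mul_assoc Xᵀ, hX, Matrix.one_mul]
    have h2 : (M * X * Xᵀ) * Mᵀ = M * X * (M * X)ᵀ := by
      rw [transpose_mul, ← Matrix.mul_assoc]
    have h3 : M * (M * X * Xᵀ)ᵀ = M * X * (M * X)ᵀ := by
      rw [transpose_mul (M * X), transpose_transpose, Matrix.mul_assoc M X]
    simp only [transpose_transpose, transpose_sub, Matrix.sub_mul, Matrix.mul_sub, trace_sub,
      h1, h2, h3]
    ring
  nlinarith [sq_nonneg ‖M - M * X * Xᵀ‖]

theorem norm_mul_diagonal_le [DecidableEq κ] (M : Matrix ι κ ℝ) {r : κ → ℝ} {c : ℝ}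
    (hc : 0 ≤ c) (hr : ∀ k, |r k| ≤ c) : ‖M * diagonal r‖ ≤ c * ‖M‖ := by
  apply le_of_sq_le_sq _ (by positivity)
  rw [mul_pow, frobenius_sq, frobenius_sq]
  simp only [mul_diagonal, Finset.mul_sum]
  refine Finset.sum_le_sum fun i _ => Finset.sum_le_sum fun k _ => ?_
  rw [mul_pow, mul_comm]
  exact mul_le_mul_of_nonneg_right (sq_le_sq.2 ((hr k).trans (le_abs_self c))) (sq_nonneg _)

theorem norm_mul_diagonal_inv_le [DecidableEq κ] {σ : ℝ} (hσ : 0 < σ) {t : κ → ℝ}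
    (ht : ∀ k, σ < t k) (M : Matrix ι κ ℝ) : ‖M * diagonal fun k => (t k)⁻¹‖ ≤ ‖M‖ / σ := by
  rw [div_eq_inv_mul]
  refine norm_mul_diagonal_le M (inv_nonneg.2 hσ.le) fun k => ?_
  rw [abs_of_pos (inv_pos.2 (hσ.trans (ht k)))]
  exact inv_anti₀ hσ (ht k).le

/-- If `SᵀS` is close to `G` and `SSᵀ` is close to `H`, then a subspace on which `G` is at least
`lam` and one on which `H` is at most `mu` have complementary dimensions, unless `lam` is
almost at most `mu`. -/
theorem le_add_of_card_lt [DecidableEq α] {β : Type*} [Fintype β] [DecidableEq β]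
    {G : Matrix ι ι ℝ} {H : Matrix ρ ρ ℝ} {S : Matrix ρ ι ℝ} {θ lam mu : ℝ}
    (hG : ‖Sᵀ * S - G‖ ≤ θ) (hH : ‖S * Sᵀ - H‖ ≤ θ)
    {X : Matrix ι α ℝ} (hX : Xᵀ * X = 1) {g : α → ℝ} (hXG : Xᵀ * G * X = diagonal g)
    (hg : ∀ a, lam ≤ g a)
    {Y : Matrix ρ β ℝ} (hY : Yᵀ * Y = 1) {h : β → ℝ} (hYH : Yᵀ * H * Y = diagonal h)
    (hh : ∀ b, h b ≤ mu) (hmu : 0 ≤ mu)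
    (hcard : Fintype.card ρ < Fintype.card α + Fintype.card β) : lam ≤ mu + 2 * θ := by
  by_contra! hlt
  have hθ : 0 ≤ θ := (norm_nonneg _).trans hG
  -- By dimension count the ranges of `S X` and `Y` share a vector `w = S X c = Y d` with `(c, d) ≠
  -- 0`. Closeness to `G` bounds `‖w‖²` below by `(lam - θ) ‖c‖²`, closeness to `H` bounds `‖Sᵀ w‖²`
  -- above by `(mu + θ) ‖w‖²`, and Cauchy–Schwarz for `‖w‖² = ⟨X c, Sᵀ w⟩` joins the two.
  obtain ⟨v, hv, hv0⟩ : ∃ v : α ⊕ β → ℝ, fromCols (S * X) (-Y) *ᵥ v = 0 ∧ v ≠ 0 := by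
    have := LinearMap.ker_ne_bot_of_finrank_lt (f := (fromCols (S * X) (-Y)).mulVecLin)
      (by simpa using hcard)
    exact (Submodule.ne_bot_iff _).1 this
  -- One-column matrices, so that the trace and Frobenius identities apply to vectors.
  let c : Matrix α Unit ℝ := of fun a _ => v (.inl a)
  let d : Matrix β Unit ℝ := of fun b _ => v (.inr b)
  have hSY : S * (X * c) = Y * d := by
    ext i j
    have h1 := congrFun hv i
    simp only [mulVec, dotProduct, fromCols, of_apply, Fintype.sum_sum_type, Sum.elim_inl,
      Sum.elim_inr, Matrix.neg_apply, neg_mul, Finset.sum_neg_distrib, Pi.zero_apply] at h1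
    rw [← Matrix.mul_assoc, mul_apply, mul_apply]
    simp only [c, d, of_apply]
    linarith
  have hc : c ≠ 0 := by
    intro hc
    have hd : ‖d‖ = 0 := by rw [← norm_isometry_mul hY, ← hSY, hc]; simp
    rw [norm_eq_zero] at hd
    apply hv0
    ext (a | b)
    · exact congrFun (congrFun hc a) ()
    · exact congrFun (congrFun hd b) ()
  have hcpos : 0 < ‖c‖ ^ 2 := by have := norm_pos_iff.2 hc; positivity
  have hxc : ‖X * c‖ = ‖c‖ := norm_isometry_mul hX c
  have hyd : ‖Y * d‖ = ‖d‖ := norm_isometry_mul hY d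
  have h1 : (lam - θ) * ‖c‖ ^ 2 ≤ ‖d‖ ^ 2 := by
    have e1 : ‖d‖ ^ 2 = ((X * c)ᵀ * (Sᵀ * S - G) * (X * c)).trace
        + (cᵀ * diagonal g * c).trace := by
      rw [← hyd, ← hSY, frobenius_sq_eq_trace, ← hXG, ← trace_add]
      congr 1
      simp only [transpose_mul, Matrix.mul_sub, Matrix.sub_mul, Matrix.mul_assoc]
      abel
    have e2 := (abs_le.1 (abs_trace_conj_le (Sᵀ * S - G) (X * c))).1
    have e3 : lam * ‖c‖ ^ 2 ≤ (cᵀ * diagonal g * c).trace := by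
      rw [trace_conj_diagonal, frobenius_sq, Finset.mul_sum]
      exact Finset.sum_le_sum fun a _ => mul_le_mul_of_nonneg_right (hg a)
        (Finset.sum_nonneg fun _ _ => sq_nonneg _)
    rw [hxc] at e2
    nlinarith [mul_le_mul_of_nonneg_right hG hcpos.le]
  have h2 : ‖Sᵀ * (Y * d)‖ ^ 2 ≤ (mu + θ) * ‖d‖ ^ 2 := by
    have e1 : ‖Sᵀ * (Y * d)‖ ^ 2 = ((Y * d)ᵀ * (S * Sᵀ - H) * (Y * d)).trace
        + (dᵀ * diagonal h * d).trace := by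
      rw [frobenius_sq_eq_trace, ← hYH, ← trace_add]
      congr 1
      simp only [transpose_mul, transpose_transpose, Matrix.mul_sub, Matrix.sub_mul,
        Matrix.mul_assoc]
      abel
    have e2 := (abs_le.1 (abs_trace_conj_le (S * Sᵀ - H) (Y * d))).2
    have e3 : (dᵀ * diagonal h * d).trace ≤ mu * ‖d‖ ^ 2 := by
      rw [trace_conj_diagonal, frobenius_sq, Finset.mul_sum]
      exact Finset.sum_le_sum fun a _ => mul_le_mul_of_nonneg_right (hh a)
        (Finset.sum_nonneg fun _ _ => sq_nonneg _)
    rw [hyd] at e2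
    nlinarith [mul_le_mul_of_nonneg_right hH (sq_nonneg ‖d‖)]
  have h3 : ‖d‖ ^ 2 ≤ ‖c‖ * ‖Sᵀ * (Y * d)‖ := by
    have e1 : ‖d‖ ^ 2 = ((X * c)ᵀ * (Sᵀ * (Y * d))).trace := by
      rw [← hyd, frobenius_sq_eq_trace]
      nth_rewrite 1 [← hSY]
      simp only [transpose_mul, Matrix.mul_assoc]
    rw [e1, ← hxc]
    exact (le_abs_self _).trans (abs_trace_transpose_mul_le _ _)
  have hd : 0 < ‖d‖ ^ 2 := by nlinarith
  have h4 : (‖d‖ ^ 2) ^ 2 ≤ ‖c‖ ^ 2 * ((mu + θ) * ‖d‖ ^ 2) :=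
    calc (‖d‖ ^ 2) ^ 2 ≤ (‖c‖ * ‖Sᵀ * (Y * d)‖) ^ 2 := pow_le_pow_left₀ hd.le h3 2
      _ = ‖c‖ ^ 2 * ‖Sᵀ * (Y * d)‖ ^ 2 := by ring
      _ ≤ _ := mul_le_mul_of_nonneg_left h2 hcpos.le
  have h5 : ‖d‖ ^ 2 ≤ ‖c‖ ^ 2 * (mu + θ) := by
    apply le_of_mul_le_mul_right _ hd
    nlinarith
  nlinarith

/-- The eigenvalues of `G` and `H` are close when `SᵀS` is close to `G` and `SSᵀ` to `H`. -/
theorem eigenvalue_le_add {n q : ℕ} {G : Matrix (Fin n) (Fin n) ℝ}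
    {H : Matrix (Fin q) (Fin q) ℝ} {S : Matrix (Fin q) (Fin n) ℝ} {θ : ℝ}
    (hG : ‖Sᵀ * S - G‖ ≤ θ) (hH : ‖S * Sᵀ - H‖ ≤ θ)
    {V : Matrix (Fin n) (Fin n) ℝ} (hV : Vᵀ * V = 1) {g : ℕ → ℝ}
    (hVG : Vᵀ * G * V = diagonal fun i : Fin n => g i) (hg : Antitone g)
    {P : Matrix (Fin q) (Fin q) ℝ} (hP : Pᵀ * P = 1) {h : ℕ → ℝ}
    (hPH : Pᵀ * H * P = diagonal fun i : Fin q => h i) (hh : Antitone h) (hh0 : ∀ i, 0 ≤ h i)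
    {i : ℕ} (hi : i < n) : g i ≤ h i + 2 * θ := by
  have hsub : ∀ {N M : ℕ} {f : Fin M → Fin N}, Function.Injective f →
      ∀ {R L : Matrix (Fin N) (Fin N) ℝ} {d : Fin N → ℝ}, Rᵀ * L * R = diagonal d →
      (R.submatrix id f)ᵀ * L * R.submatrix id f = diagonal (d ∘ f) := by
    intro N M f hf R L d hR
    rw [← submatrix_diagonal _ _ hf, ← hR]
    ext a b
    simp [mul_apply]
  have hf1 : Function.Injective (Fin.castLE (Nat.succ_le_of_lt hi) : Fin (i + 1) → Fin n) :=
    Fin.castLE_injective _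
  -- Courant–Fischer: the first `i + 1` columns of `V` against the last `q - i` of `P`, one more
  -- than `q` in total. For `i ≥ q` the second family is empty and the count still holds.
  let f2 : Fin (q - i) → Fin q := fun j => ⟨i + j, by have := j.isLt; omega⟩
  have hf2 : Function.Injective f2 := by
    intro a b hab
    simp only [f2, Fin.mk.injEq] at hab
    exact Fin.ext (by omega)
  have hone : ∀ {N M : ℕ} {f : Fin M → Fin N}, Function.Injective f →
      ∀ {R : Matrix (Fin N) (Fin N) ℝ}, Rᵀ * R = 1 →
      (R.submatrix id f)ᵀ * R.submatrix id f = 1 := by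
    intro N M f hf R hR
    have h1 := hsub hf (R := R) (L := 1) (d := 1) (by simpa using hR)
    simpa using h1
  refine le_add_of_card_lt hG hH (hone hf1 hV) (hsub hf1 hVG) (fun a => ?_) (hone hf2 hP)
    (hsub hf2 hPH) (fun b => ?_) (hh0 i) ?_
  · exact hg (Nat.le_of_lt_succ a.isLt)
  · exact hh (Nat.le_add_right _ _)
  · simp only [Fintype.card_fin]; omega

/-- The error of the approximation `A V̂ V̂ᵀ` with `V̂ = Sᵀ Û Σ̂⁻¹`. -/
theorem norm_sub_mul_transpose_sq_le [DecidableEq α] {A : Matrix ι κ ℝ} {S : Matrix ρ κ ℝ}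
    {H : Matrix ρ ρ ℝ} {θ σ : ℝ} (hσ : 0 < σ) (hG : ‖Sᵀ * S - Aᵀ * A‖ ≤ θ)
    (hH : ‖S * Sᵀ - H‖ ≤ θ) (hS : ‖S‖ = ‖A‖)
    {L : Matrix ρ α ℝ} (hL : Lᵀ * L = 1) {t : α → ℝ} (ht : ∀ a, σ < t a)
    (hHL : H * L = L * diagonal fun a => t a ^ 2) (htA : ∑ a, t a ^ 2 ≤ ‖A‖ ^ 2)
    {R : Matrix κ α ℝ} (hR : R = Sᵀ * L * diagonal fun a => (t a)⁻¹) :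
    ‖A - A * R * Rᵀ‖ ^ 2 ≤ ‖A‖ ^ 2 - ∑ a, t a ^ 2
      + (θ * (‖A‖ / σ) ^ 2 + 2 * ‖A‖ * (θ / σ) + ‖A‖ ^ 4 * θ / σ ^ 4) := by
  have hθ : 0 ≤ θ := (norm_nonneg _).trans hG
  have ht0 : ∀ a, t a ≠ 0 := fun a => (hσ.trans (ht a)).ne'
  let D : Matrix α α ℝ := diagonal fun a => (t a)⁻¹
  have hDT : Dᵀ = D := diagonal_transpose _
  have hRn : ‖R‖ ≤ ‖A‖ / σ := by
    rw [hR, ← hS, ← frobenius_norm_transpose S]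
    exact (norm_mul_diagonal_inv_le hσ ht _).trans (div_le_div_of_nonneg_right (norm_mul_isometry_le hL _) hσ.le)
  have hLD : ‖(S * Sᵀ - H) * L * D‖ ≤ θ / σ :=
    (norm_mul_diagonal_inv_le hσ ht _).trans (div_le_div_of_nonneg_right ((norm_mul_isometry_le hL _).trans hH) hσ.le)
  have hHLD : H * L * D = L * diagonal t := by
    rw [hHL, Matrix.mul_assoc, diagonal_mul_diagonal]
    congr 2
    ext a
    have := ht0 a
    field_simp
  -- If `SSᵀ` were `H`, then `RᵀR = D Lᵀ H L D` would be the identity; the defect is `D Lᵀ (SSᵀ - H)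
  -- L D`, and each `D` costs a factor `1 / σ`.
  have hE : ‖Rᵀ * R - 1‖ ≤ θ / σ ^ 2 := by
    have e1 : Rᵀ * R - 1 = (((S * Sᵀ - H) * L * D)ᵀ * L * D)ᵀ := by
      have e2 : D * (Lᵀ * (H * L * D)) = 1 := by
        rw [hHLD, ← Matrix.mul_assoc Lᵀ, hL, Matrix.one_mul, diagonal_mul_diagonal, ← diagonal_one]
        congr 1
        ext a
        exact inv_mul_cancel₀ (ht0 a)
      rw [← e2, hR]
      simp only [transpose_mul, transpose_transpose, hDT, Matrix.mul_sub, Matrix.sub_mul,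
        Matrix.mul_assoc]
      simp only [← Matrix.mul_assoc, D, diagonal_transpose]
    rw [e1, frobenius_norm_transpose, sq, ← div_div]
    refine (norm_mul_diagonal_inv_le hσ ht _).trans (div_le_div_of_nonneg_right ?_ hσ.le)
    refine (norm_mul_isometry_le hL _).trans ?_
    rwa [frobenius_norm_transpose]
  have hSR : ∑ a, t a ^ 2 - 2 * ‖A‖ * (θ / σ) ≤ ‖S * R‖ ^ 2 := by
    have e1 : ‖L * diagonal t‖ ^ 2 = ∑ a, t a ^ 2 := by
      rw [norm_isometry_mul hL, frobenius_sq_eq_trace, diagonal_transpose, diagonal_mul_diagonal,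
        trace_diagonal]
      exact Finset.sum_congr rfl fun a _ => (sq _).symm
    have e2 : S * R - L * diagonal t = (S * Sᵀ - H) * L * D := by
      rw [← hHLD, hR]
      simp only [Matrix.sub_mul, Matrix.mul_assoc, D]
    have e3 : ‖L * diagonal t‖ ≤ ‖S * R‖ + θ / σ := by
      have := norm_sub_norm_le (L * diagonal t) (S * R)
      rw [norm_sub_rev, e2] at this
      linarith
    have e4 : ‖L * diagonal t‖ ≤ ‖A‖ := le_of_sq_le_sq (e1 ▸ htA) (norm_nonneg _)
    have e5 : 0 ≤ θ / σ := by positivity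
    rw [← e1]
    have e6 := mul_le_mul_of_nonneg_right e4 e5
    -- Squaring `‖L diag t‖ - θ / σ ≤ ‖S R‖` needs a nonnegative left side; otherwise the claimed
    -- lower bound is itself nonpositive.
    rcases le_total ‖L * diagonal t‖ (θ / σ) with h | h
    · nlinarith [mul_le_mul_of_nonneg_left h (norm_nonneg (L * diagonal t)),
        mul_nonneg (norm_nonneg A) e5, sq_nonneg ‖S * R‖]
    · nlinarith [pow_le_pow_left₀ (sub_nonneg.2 h) (sub_le_iff_le_add.2 e3) 2, sq_nonneg (θ / σ)]
  have hAR : ‖S * R‖ ^ 2 - θ * (‖A‖ / σ) ^ 2 ≤ ‖A * R‖ ^ 2 := by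
    have e1 : ‖S * R‖ ^ 2 = (Rᵀ * (Sᵀ * S - Aᵀ * A) * R).trace + ‖A * R‖ ^ 2 := by
      rw [frobenius_sq_eq_trace, frobenius_sq_eq_trace, ← trace_add]
      congr 1
      simp only [transpose_mul, Matrix.mul_sub, Matrix.sub_mul, Matrix.mul_assoc]
      abel
    have e2 := (abs_le.1 (abs_trace_conj_le (Sᵀ * S - Aᵀ * A) R)).2
    have e3 : ‖Sᵀ * S - Aᵀ * A‖ * ‖R‖ ^ 2 ≤ θ * (‖A‖ / σ) ^ 2 :=
      mul_le_mul hG (pow_le_pow_left₀ (norm_nonneg _) hRn 2) (sq_nonneg _) hθ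
    linarith
  have hM : |((A * R)ᵀ * (A * R) * (Rᵀ * R - 1)).trace| ≤ ‖A‖ ^ 4 * θ / σ ^ 4 := by
    have e0 : ((A * R)ᵀ * (A * R))ᵀ = (A * R)ᵀ * (A * R) := by
      rw [transpose_mul, transpose_transpose]
    have e1 : ‖A * R‖ ≤ ‖A‖ * (‖A‖ / σ) :=
      (frobenius_norm_mul _ _).trans (mul_le_mul_of_nonneg_left hRn (norm_nonneg _))
    have e2 : ‖(A * R)ᵀ * (A * R)‖ ≤ (‖A‖ * (‖A‖ / σ)) ^ 2 := by
      refine (frobenius_norm_mul _ _).trans ?_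
      rw [frobenius_norm_transpose, ← sq]
      exact pow_le_pow_left₀ (norm_nonneg _) e1 2
    rw [← e0]
    refine (abs_trace_transpose_mul_le _ _).trans ?_
    refine (mul_le_mul e2 hE (norm_nonneg _) (sq_nonneg _)).trans (le_of_eq ?_)
    field_simp
  -- Pythagoras with a correction term for the failure of `R` to be orthonormal.
  have hexp : ‖A - A * R * Rᵀ‖ ^ 2 = ‖A‖ ^ 2 - ‖A * R‖ ^ 2
      + ((A * R)ᵀ * (A * R) * (Rᵀ * R - 1)).trace := by
    have e1 : ‖A - A * R * Rᵀ‖ ^ 2 = ‖A‖ ^ 2 - (Aᵀ * (A * R * Rᵀ)).trace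
        - ((A * R * Rᵀ)ᵀ * A).trace + ((A * R * Rᵀ)ᵀ * (A * R * Rᵀ)).trace := by
      rw [frobenius_sq_eq_trace, frobenius_sq_eq_trace]
      simp only [transpose_sub, Matrix.sub_mul, Matrix.mul_sub, trace_sub]
      ring
    have e2 : (Aᵀ * (A * R * Rᵀ)).trace = ‖A * R‖ ^ 2 := by
      rw [frobenius_sq_eq_trace, ← Matrix.mul_assoc, trace_mul_comm, transpose_mul,
        Matrix.mul_assoc]
    have e3 : ((A * R * Rᵀ)ᵀ * A).trace = ‖A * R‖ ^ 2 := by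
      rw [← e2, ← trace_transpose, transpose_mul, transpose_transpose]
    have e4 : ((A * R * Rᵀ)ᵀ * (A * R * Rᵀ)).trace
        = ((A * R)ᵀ * (A * R) * (Rᵀ * R)).trace := by
      rw [transpose_mul (A * R), transpose_transpose, Matrix.mul_assoc, trace_mul_comm]
      simp only [Matrix.mul_assoc]
    rw [e1, e2, e3, e4, Matrix.mul_sub, trace_sub, Matrix.mul_one, ← frobenius_sq_eq_trace]
    ring
  rw [hexp]
  linarith [(abs_le.1 hM).2]

end Frobenius

/-! ### Singular values and the deterministic guarantee -/

section SVD

open Matrix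

/-- The list `s` extended by zeros. -/
def padded {N : ℕ} (s : Fin N → ℝ) (i : ℕ) : ℝ := if h : i < N then s ⟨i, h⟩ else 0

theorem padded_of_le {N : ℕ} (s : Fin N → ℝ) {i : ℕ} (h : N ≤ i) : padded s i = 0 :=
  dif_neg h.not_gt

theorem padded_val {N : ℕ} (s : Fin N → ℝ) (i : Fin N) : padded s i = s i := by simp [padded]

theorem padded_nonneg {N : ℕ} {s : Fin N → ℝ} (hs : ∀ i, 0 ≤ s i) (i : ℕ) : 0 ≤ padded s i := by
  unfold padded
  split_ifs
  exacts [hs _, le_rfl]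

theorem antitone_padded_sq {N : ℕ} {s : Fin N → ℝ} (hs : ∀ i, 0 ≤ s i) (h : Antitone s) :
    Antitone fun i => padded s i ^ 2 := by
  intro i j hij
  refine pow_le_pow_left₀ (padded_nonneg hs j) ?_ 2
  by_cases hj : j < N
  · simp only [padded, hj, hij.trans_lt hj, dif_pos]
    exact h hij
  · rw [padded_of_le s (not_lt.1 hj)]
    exact padded_nonneg hs i

theorem rectDiag_transpose_mul_self {m n : ℕ} (s : Fin (min m n) → ℝ) :
    (rectDiag s : Matrix (Fin m) (Fin n) ℝ)ᵀ * rectDiag s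
      = diagonal fun j : Fin n => padded s j ^ 2 := by
  have hr : ∀ (i : Fin m) (j : Fin n),
      rectDiag s i j = if (i : ℕ) = j then padded s j else 0 := by
    intro i j
    simp only [rectDiag, of_apply, padded]
    have := i.isLt
    have := j.isLt
    split_ifs with h1 h2
    · congr 2
    · omega
    · rfl
  ext j j'
  simp only [mul_apply, transpose_apply, hr, diagonal_apply]
  by_cases hj : (j : ℕ) < m
  · rw [Finset.sum_eq_single ⟨j, hj⟩]
    · by_cases h : j = j'
      · subst h; simp [sq]
      · have h' : (j : ℕ) ≠ j' := fun e => h (Fin.ext e)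
        simp [h, h']
    · intro i _ hi
      have : (i : ℕ) ≠ j := fun e => hi (Fin.ext e)
      simp [this]
    · simp
  · have h0 : padded s j = 0 := padded_of_le s (by omega)
    simp [h0]

theorem rectDiag_mul_self_transpose {q : ℕ} (t : Fin (min q q) → ℝ) :
    rectDiag t * (rectDiag t : Matrix (Fin q) (Fin q) ℝ)ᵀ
      = diagonal fun j : Fin q => padded t j ^ 2 := by
  have hr : (rectDiag t : Matrix (Fin q) (Fin q) ℝ)ᵀ = rectDiag t := by
    ext i j
    simp only [rectDiag, of_apply, transpose_apply]
    by_cases h : (i : ℕ) = j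
    · have : i = j := Fin.ext h
      subst this; rfl
    · simp [h, Ne.symm h]
  have := rectDiag_transpose_mul_self t
  rwa [hr] at this ⊢

variable {m n : ℕ} {A : Matrix (Fin m) (Fin n) ℝ} {U : Matrix (Fin m) (Fin m) ℝ}
  {s : Fin (min m n) → ℝ} {V : Matrix (Fin n) (Fin n) ℝ}

theorem IsSVD.left_transpose_mul (h : IsSVD A U s V) : Uᵀ * U = 1 :=
  (mem_orthogonalGroup_iff' _ _).1 h.left_orthogonal

theorem IsSVD.right_transpose_mul (h : IsSVD A U s V) : Vᵀ * V = 1 :=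
  (mem_orthogonalGroup_iff' _ _).1 h.right_orthogonal

theorem IsSVD.right_mul_transpose (h : IsSVD A U s V) : V * Vᵀ = 1 :=
  (mem_orthogonalGroup_iff _ _).1 h.right_orthogonal

theorem IsSVD.gram_diagonal (h : IsSVD A U s V) :
    Vᵀ * (Aᵀ * A) * V = diagonal fun j : Fin n => padded s j ^ 2 := by
  have h1 : A * V = U * rectDiag s := by
    rw [h.eq, Matrix.mul_assoc, h.right_transpose_mul, Matrix.mul_one]
  calc Vᵀ * (Aᵀ * A) * V = (A * V)ᵀ * (A * V) := by
        simp only [transpose_mul, Matrix.mul_assoc]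
    _ = _ := by
        rw [h1, transpose_mul, Matrix.mul_assoc, ← Matrix.mul_assoc Uᵀ, h.left_transpose_mul,
          Matrix.one_mul, rectDiag_transpose_mul_self]

theorem IsSVD.cogram_diagonal {q : ℕ} {W P Q : Matrix (Fin q) (Fin q) ℝ} {t : Fin (min q q) → ℝ}
    (h : IsSVD W P t Q) :
    Pᵀ * (W * Wᵀ) * P = diagonal fun j : Fin q => padded t j ^ 2 := by
  have h1 : Pᵀ * W = rectDiag t * Qᵀ := by
    rw [h.eq, ← Matrix.mul_assoc, ← Matrix.mul_assoc, h.left_transpose_mul, Matrix.one_mul]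
  calc Pᵀ * (W * Wᵀ) * P = Pᵀ * W * (Pᵀ * W)ᵀ := by
        simp only [transpose_mul, transpose_transpose, Matrix.mul_assoc]
    _ = _ := by
        rw [h1, transpose_mul, transpose_transpose, Matrix.mul_assoc, ← Matrix.mul_assoc Qᵀ,
          h.right_transpose_mul, Matrix.one_mul, rectDiag_mul_self_transpose]

theorem IsSVD.norm_mul_right (h : IsSVD A U s V) : ‖A * V‖ = ‖A‖ := by
  rw [← frobenius_norm_transpose, transpose_mul, norm_isometry_mul, frobenius_norm_transpose]
  rw [transpose_transpose, h.right_mul_transpose]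

theorem IsSVD.norm_sq (h : IsSVD A U s V) : ‖A‖ ^ 2 = ∑ j : Fin n, padded s j ^ 2 := by
  rw [← h.norm_mul_right, frobenius_sq_eq_trace, transpose_mul, ← Matrix.mul_assoc,
    Matrix.mul_assoc Vᵀ, h.gram_diagonal, trace_diagonal]

/-- The residual is `A V d Vᵀ` with `d` the diagonal 0-1 projector onto the indices `≥ k`, and `V`
diagonalizes `AᵀA`. -/
theorem IsSVD.norm_sub_truncation_sq (h : IsSVD A U s V) (k : ℕ) :
    ‖A - truncation A V k‖ ^ 2
      = ‖A‖ ^ 2 - ∑ j ∈ Finset.univ.filter (fun j : Fin n => (j : ℕ) < k), padded s j ^ 2 := by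
  let d : Fin n → ℝ := fun j => if (j : ℕ) < k then 0 else 1
  have h1 : A - truncation A V k = A * V * diagonal d * Vᵀ := by
    have h2 : ∑ i ∈ Finset.univ.filter (fun i : Fin n => (i : ℕ) < k), vecMulVec (V.col i) (V.col i)
        = V * Vᵀ - V * diagonal d * Vᵀ := by
      ext a b
      simp only [Matrix.sum_apply, vecMulVec_apply, Matrix.sub_apply, mul_apply (N := Vᵀ),
        mul_diagonal, transpose_apply, col_apply, ← Finset.sum_sub_distrib, Finset.sum_filter, d]
      refine Finset.sum_congr rfl fun i _ => ?_
      split_ifs <;> ring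
    rw [truncation, h2, h.right_mul_transpose, Matrix.mul_sub, Matrix.mul_one, sub_sub_cancel]
    simp only [Matrix.mul_assoc]
  rw [h1, ← frobenius_norm_transpose, transpose_mul (A * V * _), transpose_transpose,
    norm_isometry_mul h.right_transpose_mul, frobenius_norm_transpose, frobenius_sq_eq_trace,
    h.norm_sq]
  have h3 : (A * V * diagonal d)ᵀ * (A * V * diagonal d)
      = diagonal d * (Vᵀ * (Aᵀ * A) * V) * diagonal d := by
    simp only [transpose_mul, diagonal_transpose, Matrix.mul_assoc]
  rw [h3, h.gram_diagonal, diagonal_mul_diagonal, diagonal_mul_diagonal, trace_diagonal,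
    Finset.sum_filter, ← Finset.sum_sub_distrib]
  refine Finset.sum_congr rfl fun j _ => ?_
  simp only [d]
  split_ifs <;> ring

/-- In a nonincreasing list the entries above `σ` form an initial segment. -/
theorem lt_numAbove_iff {N : ℕ} {t : Fin N → ℝ} (ht : Antitone t) {σ : ℝ} (a : Fin N) :
    (a : ℕ) < numAbove t σ ↔ σ < t a := by
  constructor
  · intro h
    by_contra hn
    have hsub : Finset.univ.filter (fun a => σ < t a) ⊆ Finset.Iio a := by
      intro b hb
      simp only [Finset.mem_filter, Finset.mem_univ, true_and] at hb
      rw [Finset.mem_Iio]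
      by_contra hab
      exact hn (hb.trans_le (ht (not_lt.1 hab)))
    have := Finset.card_le_card hsub
    rw [Fin.card_Iio] at this
    unfold numAbove at h
    omega
  · intro h
    have hsub : Finset.Iic a ⊆ Finset.univ.filter (fun a => σ < t a) := by
      intro b hb
      simp only [Finset.mem_filter, Finset.mem_univ, true_and]
      exact h.trans_le (ht (Finset.mem_Iic.1 hb))
    have := Finset.card_le_card hsub
    rw [Fin.card_Iic] at this
    unfold numAbove
    omega

theorem topVals_inv {N : ℕ} {t : Fin N → ℝ} (ht : Antitone t) {σ : ℝ} (hσ : 0 < σ) :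
    (topVals t σ)⁻¹ = diagonal fun a => (t (Fin.castLE (numAbove_le t σ) a))⁻¹ := by
  apply inv_eq_right_inv
  rw [topVals, diagonal_mul_diagonal, ← diagonal_one]
  congr 1
  ext a
  exact mul_inv_cancel₀ (hσ.trans ((lt_numAbove_iff ht (Fin.castLE (numAbove_le t σ) a)).1 a.isLt)).ne'

/-- ModFKV succeeds when both sampling steps preserve the Gram matrices. -/
theorem outputMatrix_guarantee {q : ℕ} {W : Matrix (Fin q) (Fin q) ℝ} {I : Fin q → Fin m}
    {P Q : Matrix (Fin q) (Fin q) ℝ} {t : Fin (min q q) → ℝ}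
    (hA : IsSVD A U s V) (hW : IsSVD W P t Q) {σ e θ : ℝ} (hσ : 0 < σ) (hσA : σ ≤ ‖A‖)
    (he : 0 < e) (heA : e * ‖A‖ ≤ σ / 16) (hθ : θ = e * σ ^ 4 / (8 * ‖A‖ ^ 2))
    (hG : ‖(rowSample A I)ᵀ * rowSample A I - Aᵀ * A‖ ≤ θ)
    (hH : ‖rowSample A I * (rowSample A I)ᵀ - W * Wᵀ‖ ≤ θ)
    (hS : ‖rowSample A I‖ = ‖A‖) (hWA : ‖W‖ = ‖A‖) :
    ‖A - outputMatrix A I P t σ‖ ^ 2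
        ≤ ‖A - truncation A V (numAbove t σ)‖ ^ 2 + e * ‖A‖ ^ 2 ∧
      (outputMatrix A I P t σ).rank ≤ numAbove t σ ∧
      ell s (σ + e * ‖A‖) ≤ numAbove t σ ∧
      numAbove t σ ≤ ell s (σ - e * ‖A‖) := by
  set F := ‖A‖ with hF
  have hF0 : 0 < F := hσ.trans_le hσA
  have hθ0 : 0 ≤ θ := (norm_nonneg _).trans hG
  have hθF : 8 * F ^ 2 * θ = e * σ ^ 4 := by rw [hθ]; field_simp
  -- Moving the threshold by `e F` changes its square by about `2 σ e F`, which dominates the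
  -- eigenvalue error `2θ`.
  have hθ1 : 8 * θ ≤ σ * (e * F) := by
    have h1 : σ ^ 3 ≤ F ^ 3 := pow_le_pow_left₀ hσ.le hσA 3
    have h2 : F ^ 2 * (8 * θ) ≤ F ^ 2 * (σ * (e * F)) := by
      nlinarith [mul_le_mul_of_nonneg_left h1 (mul_pos he hσ).le]
    exact le_of_mul_le_mul_left h2 (by positivity)
  have heF : 0 < e * F := by positivity
  have hts := antitone_padded_sq hW.nonneg hW.antitone
  have hss := antitone_padded_sq hA.nonneg hA.antitone
  have hAW : ∀ i, padded s i ^ 2 ≤ padded t i ^ 2 + 2 * θ := by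
    intro i
    by_cases hi : i < n
    · exact eigenvalue_le_add hG hH hA.right_transpose_mul hA.gram_diagonal hss
        hW.left_transpose_mul hW.cogram_diagonal hts (fun _ => sq_nonneg _) hi
    · rw [padded_of_le s (by omega)]
      nlinarith [sq_nonneg (padded t i)]
  have hWA' : ∀ i, padded t i ^ 2 ≤ padded s i ^ 2 + 2 * θ := by
    intro i
    by_cases hi : i < q
    · exact eigenvalue_le_add (S := (rowSample A I)ᵀ) (by rwa [transpose_transpose])
        (by rwa [transpose_transpose]) hW.left_transpose_mul hW.cogram_diagonal hts
        hA.right_transpose_mul hA.gram_diagonal hss (fun _ => sq_nonneg _) hi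
    · rw [padded_of_le t (by omega)]
      nlinarith [sq_nonneg (padded s i)]
  set k := numAbove t σ with hk
  have hkq : k ≤ q := (numAbove_le t σ).trans (min_le_left q q)
  have hlt : ∀ i, i < k ↔ σ < padded t i := by
    intro i
    by_cases hi : i < min q q
    · rw [show padded t i = t ⟨i, hi⟩ from padded_val t ⟨i, hi⟩]
      exact lt_numAbove_iff hW.antitone ⟨i, hi⟩
    · rw [padded_of_le t (not_lt.1 hi)]
      exact iff_of_false (by omega) hσ.not_gt
  have htc : ∀ a : Fin k, t (Fin.castLE (numAbove_le t σ) a) = padded t a := fun a =>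
    (padded_val t _).symm
  refine ⟨?_, ?_, ?_, ?_⟩
  · have hsumt : ∑ a : Fin k, t (Fin.castLE (numAbove_le t σ) a) ^ 2
        = ∑ i ∈ Finset.range k, padded t i ^ 2 := by
      simp only [htc]
      exact Fin.sum_univ_eq_sum_range (fun i => padded t i ^ 2) k
    have hle : ∑ i ∈ Finset.range k, padded t i ^ 2 ≤ F ^ 2 := by
      have hcog : ‖W‖ ^ 2 = ∑ i ∈ Finset.range q, padded t i ^ 2 := by
        rw [hW.norm_sq]
        exact Fin.sum_univ_eq_sum_range (fun i => padded t i ^ 2) q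
      rw [← hWA, hcog]
      exact Finset.sum_le_sum_of_subset_of_nonneg (Finset.range_subset_range.2 hkq)
        fun _ _ _ => sq_nonneg _
    -- Each retained value exceeds `σ`; this bounds the accumulated eigenvalue error `2θk`.
    have hkσ : k * σ ^ 2 ≤ F ^ 2 := by
      refine le_trans ?_ hle
      have := Finset.card_nsmul_le_sum (Finset.range k) (fun i => padded t i ^ 2) (σ ^ 2)
        fun i hi => pow_le_pow_left₀ hσ.le ((hlt i).1 (Finset.mem_range.1 hi)).le 2
      simpa using this
    have hsum : ∑ j ∈ Finset.univ.filter (fun j : Fin n => (j : ℕ) < k), padded s j ^ 2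
        ≤ ∑ i ∈ Finset.range k, padded t i ^ 2 + 2 * θ * k := by
      have h1 : ∑ j ∈ Finset.univ.filter (fun j : Fin n => (j : ℕ) < k), padded s j ^ 2
          ≤ ∑ i ∈ Finset.range k, padded s i ^ 2 := by
        rw [Finset.sum_filter, Fin.sum_univ_eq_sum_range
          (fun i => if i < k then padded s i ^ 2 else 0) n, ← Finset.sum_filter]
        exact Finset.sum_le_sum_of_subset_of_nonneg
          (fun i hi => Finset.mem_range.2 (Finset.mem_filter.1 hi).2) fun _ _ _ => sq_nonneg _
      refine h1.trans ((Finset.sum_le_sum fun i _ => hAW i).trans (le_of_eq ?_))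
      rw [Finset.sum_add_distrib]
      simp [mul_comm]
    have hL : (leftVecs P t σ)ᵀ * leftVecs P t σ = 1 := by
      have h1 : (leftVecs P t σ)ᵀ * leftVecs P t σ = (Pᵀ * P).submatrix
          (Fin.castLE hkq) (Fin.castLE hkq) := by
        ext a b
        simp [mul_apply, leftVecs]
      rw [h1, hW.left_transpose_mul, submatrix_one _ (Fin.castLE_injective _)]
    have hHL : W * Wᵀ * leftVecs P t σ = leftVecs P t σ *
        diagonal fun a => t (Fin.castLE (numAbove_le t σ) a) ^ 2 := by
      have h1 : W * Wᵀ * P = P * diagonal fun j : Fin q => padded t j ^ 2 := by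
        rw [← hW.cogram_diagonal, ← Matrix.mul_assoc, ← Matrix.mul_assoc,
          (mem_orthogonalGroup_iff _ _).1 hW.left_orthogonal, Matrix.one_mul]
      ext r a
      have h2 := congrFun (congrFun h1 r) (Fin.castLE hkq a)
      rw [mul_diagonal] at h2
      rw [mul_diagonal, htc]
      exact h2
    have key := norm_sub_mul_transpose_sq_le hσ hG hH hS hL
      (fun a => (lt_numAbove_iff hW.antitone (Fin.castLE (numAbove_le t σ) a)).1 a.isLt)
      hHL (hsumt ▸ hle) (R := approxRight A I P t σ)
      (by rw [approxRight, topVals_inv hW.antitone hσ])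
    rw [hsumt] at key
    rw [hA.norm_sub_truncation_sq, outputMatrix]
    refine key.trans ?_
    -- Error budget in units of `e F² / 8`: the four bounds cost 1, 2, 1 and 2.
    have e1 : θ * (F / σ) ^ 2 ≤ e * F ^ 2 / 8 := by
      rw [hθ]
      have : e * σ ^ 4 / (8 * F ^ 2) * (F / σ) ^ 2 = e * σ ^ 2 / 8 := by field_simp
      rw [this]
      have := mul_le_mul_of_nonneg_left (pow_le_pow_left₀ hσ.le hσA 2) he.le
      linarith
    have e2 : 2 * F * (θ / σ) ≤ 2 * (e * F ^ 2 / 8) := by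
      have : 2 * F * (θ / σ) = 2 * F * θ / σ := by ring
      rw [this, div_le_iff₀ hσ]
      nlinarith
    have e3 : F ^ 4 * θ / σ ^ 4 = e * F ^ 2 / 8 := by rw [hθ]; field_simp
    have e4 : 2 * θ * k ≤ 2 * (e * F ^ 2 / 8) := by
      have h1 : θ ≤ e * σ ^ 2 / 8 := by
        have h2 : F ^ 2 * (8 * θ) ≤ F ^ 2 * (e * σ ^ 2) := by
          have := mul_le_mul_of_nonneg_left (pow_le_pow_left₀ hσ.le hσA 2)
            (mul_pos he (pow_pos hσ 2)).le
          nlinarith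
        have := le_of_mul_le_mul_left h2 (by positivity)
        linarith
      have h2 := mul_le_mul_of_nonneg_right h1 (Nat.cast_nonneg (α := ℝ) k)
      nlinarith
    have : 0 < e * F ^ 2 := by positivity
    linarith
  · rw [outputMatrix]
    exact (rank_mul_le_right _ _).trans ((rank_le_card_height _).trans (by simp [hk]))
  · refine Finset.sup_le fun i hi => ?_
    have hi' := (Finset.mem_filter.1 hi).2
    rw [← padded_val s i] at hi'
    apply Nat.succ_le_of_lt
    rw [hlt]
    apply lt_of_pow_lt_pow_left₀ 2 (padded_nonneg hW.nonneg _)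
    have h1 := pow_le_pow_left₀ (by positivity) hi' 2
    nlinarith [hAW i]
  · by_cases hk0 : k = 0
    · rw [hk0]; exact Nat.zero_le _
    · have h1 : σ < padded t (k - 1) := (hlt _).1 (by omega)
      have h2 := hWA' (k - 1)
      have h3 : σ ^ 2 < padded t (k - 1) ^ 2 := pow_lt_pow_left₀ h1 hσ.le (by norm_num)
      have h4 : (σ - e * F) ^ 2 < padded s (k - 1) ^ 2 := by nlinarith
      have h5 := lt_of_pow_lt_pow_left₀ 2 (padded_nonneg hA.nonneg _) h4
      -- Beyond `min m n` the padded value is `0`, impossible since `e F ≤ σ / 16` keeps `σ - e F`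
      -- positive.
      have h6 : k - 1 < min m n := by
        by_contra hn
        rw [padded_of_le s (not_lt.1 hn)] at h5
        linarith
      have h7 := Finset.le_sup (s := Finset.univ.filter fun i => σ - e * F ≤ s i)
        (f := fun i => (i : ℕ) + 1) (b := ⟨k - 1, h6⟩)
        (by simpa [padded, h6] using h5.le)
      simp only at h7
      unfold ell
      omega

end SVD

/-! ### The two sampling steps and Markov's inequality -/

section ModFKV

open Matrix

theorem scaledRows_row_sq {ι κ : Type*} [Fintype ι] [Fintype κ] {p : ι → ℝ} {B : Matrix ι κ ℝ}
    (hB : ∀ i, p i * ‖B‖ ^ 2 = ∑ k, B i k ^ 2) {q : ℕ} (hq : 0 < q) {I : Fin q → ι} {r : Fin q}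
    (hI : 0 < p (I r)) : ∑ k, scaledRows p B I r k ^ 2 = ‖B‖ ^ 2 / q := by
  have hq' : (0 : ℝ) < q := by exact_mod_cast hq
  simp only [scaledRows, of_apply, div_pow, Real.sq_sqrt (mul_pos hq' hI).le,
    ← Finset.sum_div, ← hB]
  field_simp

/-- Exact, not merely in expectation: rescaling gives every sampled row the same squared length
`‖B‖² / q`. -/
theorem norm_scaledRows {ι κ : Type*} [Fintype ι] [Fintype κ] {p : ι → ℝ} {B : Matrix ι κ ℝ}
    (hB : ∀ i, p i * ‖B‖ ^ 2 = ∑ k, B i k ^ 2) {q : ℕ} (hq : 0 < q) {I : Fin q → ι}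
    (hI : ∀ r, 0 < p (I r)) : ‖scaledRows p B I‖ = ‖B‖ := by
  have hq' : (0 : ℝ) < q := by exact_mod_cast hq
  apply (sq_eq_sq₀ (norm_nonneg _) (norm_nonneg _)).1
  simp only [frobenius_sq (scaledRows p B I), scaledRows_row_sq hB hq (hI _)]
  simp only [Finset.sum_const, Finset.card_univ, Fintype.card_fin, nsmul_eq_mul]
  field_simp

variable {m n q : ℕ} {A : Matrix (Fin m) (Fin n) ℝ}

theorem norm_rowVec_sq (A : Matrix (Fin m) (Fin n) ℝ) (i : Fin m) :
    ‖rowVec A i‖ ^ 2 = ∑ j, A i j ^ 2 := by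
  rw [EuclideanSpace.real_norm_sq_eq]; rfl

theorem norm_rowNorms (A : Matrix (Fin m) (Fin n) ℝ) : ‖rowNorms A‖ = ‖A‖ := by
  apply (sq_eq_sq₀ (norm_nonneg _) (norm_nonneg _)).1
  rw [EuclideanSpace.real_norm_sq_eq, frobenius_sq]
  exact Finset.sum_congr rfl fun i _ => norm_rowVec_sq A i

theorem lengthSqDist_rowNorms (A : Matrix (Fin m) (Fin n) ℝ) (i : Fin m) :
    lengthSqDist (rowNorms A) i = ‖rowVec A i‖ ^ 2 / ‖A‖ ^ 2 := by
  rw [lengthSqDist, norm_rowNorms]; rfl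

theorem lengthSqDist_rowNorms_mul (hA : A ≠ 0) (i : Fin m) :
    lengthSqDist (rowNorms A) i * ‖A‖ ^ 2 = ∑ j, A i j ^ 2 := by
  have : ‖A‖ ≠ 0 := norm_ne_zero_iff.2 hA
  rw [lengthSqDist_rowNorms, ← norm_rowVec_sq]
  field_simp

theorem sum_lengthSqDist_rowNorms (hA : A ≠ 0) : ∑ i, lengthSqDist (rowNorms A) i = 1 :=
  lengthSqDist_sum _ (norm_ne_zero_iff.1 (by rw [norm_rowNorms]; exact norm_ne_zero_iff.2 hA))

theorem colDist_nonneg (A : Matrix (Fin m) (Fin n) ℝ) (I : Fin q → Fin m) (j : Fin n) :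
    0 ≤ colDist A I j :=
  Finset.sum_nonneg fun _ _ => mul_nonneg (by positivity) (lengthSqDist_nonneg _ _)

theorem norm_rowSample (hA : A ≠ 0) (hq : 0 < q) {I : Fin q → Fin m}
    (hI : ∀ r, 0 < lengthSqDist (rowNorms A) (I r)) : ‖rowSample A I‖ = ‖A‖ :=
  norm_scaledRows (lengthSqDist_rowNorms_mul hA) hq hI

/-- The rows of `S` have equal length, so the uniform mixture of their distributions is the
norm-squared distribution of the columns of `S`. The column draw is thus row sampling of `Sᵀ`. -/
theorem colDist_mul (hA : A ≠ 0) (hq : 0 < q) {I : Fin q → Fin m}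
    (hI : ∀ r, 0 < lengthSqDist (rowNorms A) (I r)) (j : Fin n) :
    colDist A I j * ‖(rowSample A I)ᵀ‖ ^ 2 = ∑ r, (rowSample A I)ᵀ j r ^ 2 := by
  have hA' : ‖A‖ ≠ 0 := norm_ne_zero_iff.2 hA
  have hq' : (0 : ℝ) < q := by exact_mod_cast hq
  rw [frobenius_norm_transpose, norm_rowSample hA hq hI, colDist, Finset.sum_mul]
  refine Finset.sum_congr rfl fun r _ => ?_
  have hr : ‖rowVec A (I r)‖ ≠ 0 := by
    intro h
    have := hI r
    rw [lengthSqDist_rowNorms, h] at this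
    simp at this
  rw [transpose_apply, rowSample, of_apply, div_pow, Real.sq_sqrt (mul_pos hq' (hI r)).le,
    lengthSqDist_rowNorms, lengthSqDist]
  have : (rowVec A (I r)) j = A (I r) j := rfl
  rw [this]
  field_simp

theorem sum_colDist (hA : A ≠ 0) (hq : 0 < q) {I : Fin q → Fin m}
    (hI : ∀ r, 0 < lengthSqDist (rowNorms A) (I r)) : ∑ j, colDist A I j = 1 := by
  have hS : ‖(rowSample A I)ᵀ‖ ^ 2 ≠ 0 := by
    rw [frobenius_norm_transpose, norm_rowSample hA hq hI]
    exact pow_ne_zero _ (norm_ne_zero_iff.2 hA)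
  apply mul_right_cancel₀ hS
  simp only [Finset.sum_mul, one_mul, colDist_mul hA hq hI]
  rw [frobenius_sq]

theorem subsample_eq_transpose (A : Matrix (Fin m) (Fin n) ℝ) (I : Fin q → Fin m)
    (J : Fin q → Fin n) :
    subsample A I J = (scaledRows (colDist A I) (rowSample A I)ᵀ J)ᵀ := by
  ext r c
  simp only [subsample, scaledRows, rowSample, of_apply, transpose_apply]
  rw [div_div, ← Real.sqrt_mul (mul_nonneg (Nat.cast_nonneg _) (lengthSqDist_nonneg _ _)),
    mul_mul_mul_comm, Real.sqrt_mul (mul_self_nonneg _), Real.sqrt_mul_self (Nat.cast_nonneg _)]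

/-- The total squared error of the two sampling steps. -/
noncomputable def samplingError (A : Matrix (Fin m) (Fin n) ℝ)
    (ω : (Fin q → Fin m) × (Fin q → Fin n)) : ℝ :=
  ‖(rowSample A ω.1)ᵀ * rowSample A ω.1 - Aᵀ * A‖ ^ 2 +
    ‖rowSample A ω.1 * (rowSample A ω.1)ᵀ - subsample A ω.1 ω.2 * (subsample A ω.1 ω.2)ᵀ‖ ^ 2

/-- Condition on the rows: given rows of positive probability, the column step has mean square error
at most `‖S‖⁴ / q = ‖A‖⁴ / q`; other row choices carry no weight. -/
theorem sum_sampleWeight_mul_samplingError_le (hA : A ≠ 0) (hq : 0 < q) :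
    ∑ ω : (Fin q → Fin m) × (Fin q → Fin n), sampleWeight A ω * samplingError A ω
      ≤ 2 * ‖A‖ ^ 4 / q := by
  set p := lengthSqDist (rowNorms A) with hp
  have hp0 : ∀ i, 0 ≤ p i := lengthSqDist_nonneg _
  have hp1 : ∑ i, p i = 1 := sum_lengthSqDist_rowNorms hA
  rw [Fintype.sum_prod_type]
  have hI : ∀ I : Fin q → Fin m,
      ∑ J : Fin q → Fin n, sampleWeight A (I, J) * samplingError A (I, J)
        ≤ (∏ r, p (I r)) * ‖(rowSample A I)ᵀ * rowSample A I - Aᵀ * A‖ ^ 2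
          + (∏ r, p (I r)) * (‖A‖ ^ 4 / q) := by
    intro I
    simp only [sampleWeight, mul_assoc, ← Finset.mul_sum, ← mul_add]
    by_cases h : ∀ r, 0 < p (I r)
    · refine mul_le_mul_of_nonneg_left ?_ (Finset.prod_nonneg fun _ _ => hp0 _)
      have h1 := sum_colDist hA hq h
      have h2 := sum_prod_mul_gram_error_le (colDist_nonneg A I) h1 (colDist_mul hA hq h) hq
      rw [frobenius_norm_transpose, norm_rowSample hA hq h] at h2
      simp only [samplingError, mul_add, Finset.sum_add_distrib, ← Finset.sum_mul,
        sum_prod_eq_one h1, one_mul]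
      gcongr
      refine le_trans (le_of_eq ?_) h2
      refine Finset.sum_congr rfl fun J _ => ?_
      rw [subsample_eq_transpose, norm_sub_rev]
      simp only [transpose_transpose]
    · push Not at h
      obtain ⟨r, hr⟩ := h
      have : ∏ r, p (I r) = 0 := Finset.prod_eq_zero (Finset.mem_univ r) (le_antisymm hr (hp0 _))
      rw [this, zero_mul, zero_mul]
  refine (Finset.sum_le_sum fun I _ => hI I).trans ?_
  rw [Finset.sum_add_distrib, ← Finset.sum_mul, sum_prod_eq_one hp1, one_mul]
  have h3 := sum_prod_mul_gram_error_le hp0 hp1 (lengthSqDist_rowNorms_mul hA) hq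
  have h4 : 2 * ‖A‖ ^ 4 / (q : ℝ) = ‖A‖ ^ 4 / q + ‖A‖ ^ 4 / q := by ring
  rw [h4]
  exact add_le_add h3 le_rfl

/-- Markov's inequality for the sampling error. -/
theorem one_sub_le_sampleProb (hA : A ≠ 0) (hq : 0 < q) {τ : ℝ} (hτ : 0 < τ)
    {E : Set ((Fin q → Fin m) × (Fin q → Fin n))}
    (hE : ∀ ω, 0 < sampleWeight A ω → samplingError A ω ≤ τ → ω ∈ E) :
    1 - 2 * ‖A‖ ^ 4 / q / τ ≤ sampleProb A E := by
  have h1 := sampleProb_univ (q := q) A hA hq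
  simp only [sampleProb, Set.indicator_univ] at h1
  have h2 := div_le_div_of_nonneg_right (sum_sampleWeight_mul_samplingError_le hA hq) hτ.le
  have h3 : ∑ ω : (Fin q → Fin m) × (Fin q → Fin n), (sampleWeight A ω - sampleWeight A ω * samplingError A ω / τ)
      ≤ sampleProb A E := by
    refine Finset.sum_le_sum fun ω _ => ?_
    have hw := sampleWeight_nonneg A ω
    have he : 0 ≤ samplingError A ω := add_nonneg (sq_nonneg _) (sq_nonneg _)
    by_cases hω : ω ∈ E
    · rw [Set.indicator_of_mem hω]
      have : 0 ≤ sampleWeight A ω * samplingError A ω / τ := by positivity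
      linarith
    · rw [Set.indicator_of_notMem hω]
      rcases hw.eq_or_lt with h | h
      · simp [← h]
      · have h4 : τ < samplingError A ω := by
          by_contra hn
          exact hω (hE ω h (not_lt.1 hn))
        rw [sub_nonpos, le_div_iff₀ hτ]
        exact mul_le_mul_of_nonneg_left h4.le hw
  rw [Finset.sum_sub_distrib, h1, ← Finset.sum_div] at h3
  linarith

theorem pos_of_sampleWeight_pos {ω : (Fin q → Fin m) × (Fin q → Fin n)}
    (hω : 0 < sampleWeight A ω) :
    (∀ r, 0 < lengthSqDist (rowNorms A) (ω.1 r)) ∧ ∀ c, 0 < colDist A ω.1 (ω.2 c) := by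
  have h1 := left_ne_zero_of_mul hω.ne'
  have h2 := right_ne_zero_of_mul hω.ne'
  rw [Finset.prod_ne_zero_iff] at h1 h2
  exact ⟨fun r => (lengthSqDist_nonneg _ _).lt_of_ne' (h1 r (Finset.mem_univ _)),
    fun c => (colDist_nonneg _ _ _).lt_of_ne' (h2 c (Finset.mem_univ _))⟩

theorem norm_subsample (hA : A ≠ 0) (hq : 0 < q) {ω : (Fin q → Fin m) × (Fin q → Fin n)}
    (hω : 0 < sampleWeight A ω) : ‖subsample A ω.1 ω.2‖ = ‖A‖ := by
  obtain ⟨h1, h2⟩ := pos_of_sampleWeight_pos hω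
  rw [subsample_eq_transpose, frobenius_norm_transpose,
    norm_scaledRows (colDist_mul hA hq h1) hq h2, frobenius_norm_transpose,
    norm_rowSample hA hq h1]

end ModFKV

theorem mainTheorem6 (δ : ℝ) (hδ0 : 0 < δ) (hδ1 : δ < 1) :
    ∃ C : ℝ, 0 < C ∧
      ∀ (m n : ℕ) (A : Matrix (Fin m) (Fin n) ℝ)
        (U : Matrix (Fin m) (Fin m) ℝ) (s : Fin (min m n) → ℝ) (V : Matrix (Fin n) (Fin n) ℝ),
        IsSVD A U s V →
      ∀ σ ε η : ℝ, 0 < σ → σ ≤ ‖A‖ → 0 < ε → ε ≤ √(σ / ‖A‖) / 4 → ε ^ 2 ≤ η → η ≤ 1 →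
      ∀ K εbar : ℝ, K = ‖A‖ ^ 2 / σ ^ 2 → εbar = η * ε ^ 2 →
      ∀ q : ℕ, C * (K ^ 4 / εbar ^ 2) ≤ (q : ℝ) →
        1 - δ ≤ sampleProb A {ω : (Fin q → Fin m) × (Fin q → Fin n) |
          ∀ (P : Matrix (Fin q) (Fin q) ℝ) (t : Fin (min q q) → ℝ) (Q : Matrix (Fin q) (Fin q) ℝ),
            IsSVD (subsample A ω.1 ω.2) P t Q →
            ‖A - outputMatrix A ω.1 P t σ‖ ^ 2
                ≤ ‖A - truncation A V (numAbove t σ)‖ ^ 2 + εbar * ‖A‖ ^ 2 ∧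
            (outputMatrix A ω.1 P t σ).rank ≤ numAbove t σ ∧
            ell s ((1 + εbar * √K) * σ) ≤ numAbove t σ ∧
            numAbove t σ ≤ ell s ((1 - εbar * √K) * σ)} := by
  -- `128 = 2 * 8²`: two sampling errors, and the `8` in the denominator of `θ`, squared.
  refine ⟨128 / δ, by positivity, ?_⟩
  intro m n A U s V hsvd σ ε η hσ hσA hε hεσ hεη hη K e hK he q hq
  have hF : 0 < ‖A‖ := hσ.trans_le hσA
  have hA : A ≠ 0 := norm_pos_iff.1 hF
  have hη0 : 0 < η := (pow_pos hε 2).trans_le hεη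
  have he0 : 0 < e := by rw [he]; positivity
  have hK0 : 0 < K := by rw [hK]; positivity
  have hq0 : (0 : ℝ) < q := lt_of_lt_of_le (by positivity) hq
  have hqn : 0 < q := by exact_mod_cast hq0
  have heA : e * ‖A‖ ≤ σ / 16 := by
    have h1 : ε ^ 2 ≤ σ / ‖A‖ / 16 := by
      refine (pow_le_pow_left₀ hε.le hεσ 2).trans (le_of_eq ?_)
      rw [div_pow, Real.sq_sqrt (by positivity)]
      norm_num
    have h2 : e ≤ σ / ‖A‖ / 16 := by
      rw [he]
      exact (mul_le_of_le_one_left (sq_nonneg ε) hη).trans h1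
    calc e * ‖A‖ ≤ σ / ‖A‖ / 16 * ‖A‖ := mul_le_mul_of_nonneg_right h2 hF.le
      _ = σ / 16 := by field_simp
  have hKσ : √K * σ = ‖A‖ := by
    rw [hK, ← div_pow, Real.sqrt_sq (by positivity)]
    field_simp
  set θ := e * σ ^ 4 / (8 * ‖A‖ ^ 2) with hθ
  have hθ0 : 0 < θ := by positivity
  have hprob : 2 * ‖A‖ ^ 4 / q / θ ^ 2 ≤ δ := by
    have h1 : 128 * (K ^ 4 / e ^ 2) ≤ q * δ := by
      have := mul_le_mul_of_nonneg_right hq hδ0.le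
      refine le_trans (le_of_eq ?_) this
      field_simp
    have h2 : 2 * ‖A‖ ^ 4 / θ ^ 2 = 128 * (K ^ 4 / e ^ 2) := by
      rw [hθ, hK]
      field_simp
      norm_num
    rw [div_right_comm, h2, div_le_iff₀ hq0, mul_comm δ]
    exact h1
  refine le_trans (by linarith) (one_sub_le_sampleProb hA hqn (pow_pos hθ0 2) ?_)
  -- The good event is fixed by the samples alone, so one `ω` serves every decomposition of `W`.
  intro ω hω hle P t Q hW
  have hle1 : (‖(rowSample A ω.1).transpose * rowSample A ω.1 - A.transpose * A‖) ^ 2 ≤ θ ^ 2 :=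
    (le_add_of_nonneg_right (sq_nonneg _)).trans hle
  have hle2 : ‖rowSample A ω.1 * (rowSample A ω.1).transpose -
      subsample A ω.1 ω.2 * (subsample A ω.1 ω.2).transpose‖ ^ 2 ≤ θ ^ 2 :=
    (le_add_of_nonneg_left (sq_nonneg _)).trans hle
  have key := outputMatrix_guarantee hsvd hW hσ hσA he0 heA hθ
    (le_of_sq_le_sq hle1 hθ0.le) (le_of_sq_le_sq hle2 hθ0.le)
    (norm_rowSample hA hqn (pos_of_sampleWeight_pos hω).1) (norm_subsample hA hqn hω)
  have e1 : (1 + e * √K) * σ = σ + e * ‖A‖ := by rw [← hKσ]; ring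
  have e2 : (1 - e * √K) * σ = σ - e * ‖A‖ := by rw [← hKσ]; ring
  rw [e1, e2]
  exact key
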